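/- Let $d\ge 1$. For a convex set $D\subset\mathbb R^d$ and positive reals $B,\Gamma_1,\dots,\Gamma_d$ (with $\Gamma=(\Gamma_1,\dots,\Gamma_d)$), let $\mathcal C(D,B,\Gamma)$ be the class of convex functions $\varphi:D\to\mathbb R$ such that $|\varphi|\le B$ on $D$ and $|\varphi(x+\lambda e_i)-\varphi(x)|\le\Gamma_i|\lambda|$ whenever $x$ and $x+\lambda e_i$ both lie in $D$ ($e_i$ the standard basis vectors). Let $\mathcal C_0(D,B,\Gamma)$ be the class of those $\varphi\in\mathcal C(D,B,\Gamma)$ with $|\varphi(x)-\varphi(y)|\le\sum_{i=1}^d\Gamma_i|x_i-y_i|$ for all $x,y\in D$. For a class $\mathcal F$ of functions on $D$ and $\varepsilon\ge 0$, let $N_{[\,]}(\varepsilon,\mathcal F,L_p)\in\{0,1,2,\dots\}\cup\{\infty\}$ be the least number of brackets $[l,u]$ (pairs of functions on $D$ with $l\le u$) with $L_p(u-l)\le\varepsilon$ such that each $f\in\mathcal F$ satisfies $l\le f\le u$ on $D$ for one of them; here $L_\infty(f)=\sup_{x\in D}|f(x)|$, and $L_p(f)=(\int_D|f|^p\,dx)^{1/p}$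 for $1\le p<\infty$, in which case $l,u$ are required to be Lebesgue measurable. **Theorem.** There are positive constants $c=c_d$ and $\varepsilon_0=\varepsilon_{0,d}$, depending only on $d$, such that the following holds for all $a_i<b_i$, every convex set $D\subseteq\prod_{i=1}^d[a_i,b_i]$ and all $B,\Gamma_1,\dots,\Gamma_d>0$. Put $M=B+\sum_{i=1}^d\Gamma_i(b_i-a_i)$. For all $0<\varepsilon\le\varepsilon_0M$ and all real $p\ge1$: 1. $\log N_{[\,]}(\varepsilon\,\mathrm{vol}(D)^{1/p},\mathcal C_0(D,B,\Gamma),L_p)\le\log N_{[\,]}(\varepsilon,\mathcal C_0(D,B,\Gamma),L_\infty)\le c\,(M/\varepsilon)^{d/2}$; 2. $\log N_{[\,]}(\varepsilon\,\mathrm{vol}(D)^{1/p},\mathcal C(D,B,\Gamma),L_p)\le\min\{\log N_{[\,]}(\varepsilon,\mathcal C(D,B,\Gamma),L_\infty),\ c\,(M/\varepsilon)^{d/2}\}$. Moreover, $\mathcal C_0(D,B,\Gamma)=\{\varphi\in\mathcal C(D,B,\Gamma):\varphi\text{ is continuous on }D\}$ if $D$ has nonempty interior, and $\mathcal C_0(D,B,\Gamma)=\mathcal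 C(D,B,\Gamma)$ if $D$ is open or $D=\prod_{i=1}^d[a_i,b_i]$. -/

import Mathlib

open MeasureTheory Set
open scoped ENNReal

noncomputable section

/-- The class of convex functions `φ` on `D`, bounded by `B` on `D`, such that
`|φ (x + t v_i) - φ x| ≤ Γ_i |t|` as long as `x` and `x + t v_i` both belong to `D`.
A function on `D` is represented by a function on the whole space, of which only the values
on `D` matter. -/
def convexLipClass {d : ℕ} (D : Set (Fin d → ℝ)) (B : ℝ) (Γ : Fin d → ℝ)
    (v : Fin d → (Fin d → ℝ)) : Set ((Fin d → ℝ) → ℝ) :=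
  {φ | ConvexOn ℝ D φ ∧ (∀ x ∈ D, |φ x| ≤ B) ∧
    ∀ (i : Fin d) (x : Fin d → ℝ) (t : ℝ), x ∈ D → x + t • v i ∈ D →
      |φ (x + t • v i) - φ x| ≤ Γ i * |t|}

/-- The class for the standard basis vectors `e_1, …, e_d`. -/
def coordLipClass {d : ℕ} (D : Set (Fin d → ℝ)) (B : ℝ) (Γ : Fin d → ℝ) :
    Set ((Fin d → ℝ) → ℝ) :=
  convexLipClass D B Γ (fun i => Pi.single i 1)

/-- The members of `coordLipClass D B Γ` that satisfy the Lipschitz condition also between points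
of `D` which are not joined inside `D` by segments parallel to the axes. -/
def jointLipClass {d : ℕ} (D : Set (Fin d → ℝ)) (B : ℝ) (Γ : Fin d → ℝ) :
    Set ((Fin d → ℝ) → ℝ) :=
  {φ | φ ∈ coordLipClass D B Γ ∧
    ∀ x ∈ D, ∀ y ∈ D, |φ x - φ y| ≤ ∑ i, Γ i * |x i - y i|}

/-- The least number `n` of brackets `[l, u]` on `D` (pairs with `l ≤ u` on `D`), each of them
satisfying the size condition `small l u`, such that every member of `F` lies on `D` in one of
them; `⊤` if finitely many do not suffice. -/
def bracketingNumber {d : ℕ} (D : Set (Fin d → ℝ)) (F : Set ((Fin d → ℝ) → ℝ))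
    (small : ((Fin d → ℝ) → ℝ) → ((Fin d → ℝ) → ℝ) → Prop) : ℕ∞ :=
  sInf {N : ℕ∞ | ∃ n : ℕ, N = (n : ℕ∞) ∧ ∃ l u : Fin n → (Fin d → ℝ) → ℝ,
    (∀ i, (∀ x ∈ D, l i x ≤ u i x) ∧ small (l i) (u i)) ∧
    ∀ f ∈ F, ∃ i, ∀ x ∈ D, l i x ≤ f x ∧ f x ≤ u i x}

/-- Logarithm of the `ε`-bracketing number for `L_∞(f) = sup_{x ∈ D} |f x|`. -/
def logBracketingSup {d : ℕ} (D : Set (Fin d → ℝ)) (F : Set ((Fin d → ℝ) → ℝ)) (ε : ℝ) : EReal :=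
  ENNReal.log (bracketingNumber D F (fun l u => ∀ x ∈ D, |u x - l x| ≤ ε) : ℝ≥0∞)

/-- Logarithm of the `ε`-bracketing number for `L_p(f) = (∫_D |f|^p)^{1/p}`; the brackets consist
of Lebesgue measurable functions on `D`. -/
def logBracketingLp {d : ℕ} (D : Set (Fin d → ℝ)) (F : Set ((Fin d → ℝ) → ℝ)) (p ε : ℝ) : EReal :=
  ENNReal.log (bracketingNumber D F (fun l u =>
    AEMeasurable l (volume.restrict D) ∧ AEMeasurable u (volume.restrict D) ∧
      eLpNorm (fun x => u x - l x) (ENNReal.ofReal p) (volume.restrict D) ≤ ENNReal.ofReal ε) :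
    ℝ≥0∞)

end

/-!
The heart of the matter is Bronshtein's entropy bound for the supremum norm. It is proved through
the resolvent of the subdifferential. Let `f` be convex and `1`-Lipschitz on a Euclidean space.
Every `z` is of the form `x + g` with `g` a subgradient of `f` at `x`, and both `x` and `g` are
nonexpansive functions of `z` (`ConvexOn.exists_isSubgradientAt_add_smul_eq`,
`IsSubgradientAt.sq_norm_sub_add_sq_norm_sub_le`). So, if `z` and `z'` are at distance `O(δ)`, the
affine functions supporting `f` at `x` and `x'` differ by `O(δ ^ 2)` at points at distance `O(δ)`
from `x` (`IsSubgradientAt.abs_affine_sub_affine_le`). It follows that `f` is determined up to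
`O(δ ^ 2)` on the unit cube by the supporting affine functions belonging to the points `z` of a
grid of mesh `δ` in a bounded region, rounded to precision `δ` in base point and slope and to
precision `δ ^ 2` in value (`le_add_of_isSample`). To count such families of rounded data without a
factor `log (1 / δ)`, the grid is made into a tree by joining `k` to `k - 1`: along an edge, the
increment of the data takes a number of values bounded in terms of `d` only
(`IsSample.sampleIncrement_mem`), and the data at the root take polynomially many values in
`1 / δ`. With `O(δ ^ (-d))` grid points this gives `exp (C * δ ^ (-d))` families, and `ε`
corresponds to `δ ^ 2`.

A function in `jointLipClass D B Γ` extends to a convex function on the whole space with the same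
Lipschitz constants, by infimal convolution. Rescaling the box to the unit cube and dividing by
`M = B + ∑ i, Γ i * (b i - a i)` leads to the normalized situation
(`exists_logBracketingSup_jointLipClass_le`).

For the `L_p` norms, a bracket for the supremum norm is shrunk to the infimum and the supremum of
its members, which are measurable because the members are continuous in the interior of `D`, while
the boundary of a convex set is a null set. For the same reason one may pass from `D` to its
interior, where the Lipschitz condition along the axes implies the joint one: a segment can be
followed by small steps parallel to the axes (`jointLipClass_of_isOpen`).
-/

open scoped RealInnerProductSpace

/-! ### Subgradients and the resolvent of a convex function -/

/-- `g` is a subgradient of `f` at `x`: the affine function through `(x, f x)` with slope `g`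
is a global minorant of `f`. -/
def IsSubgradientAt {E : Type*} [NormedAddCommGroup E] [InnerProductSpace ℝ E]
    (f : E → ℝ) (x g : E) : Prop :=
  ∀ w, f x + ⟪g, w - x⟫ ≤ f w

namespace IsSubgradientAt

variable {E : Type*} [NormedAddCommGroup E] [InnerProductSpace ℝ E] {f : E → ℝ} {x x' g g' : E}

theorem norm_le_one (h : IsSubgradientAt f x g) (hf : ∀ x y, f x - f y ≤ ‖x - y‖) : ‖g‖ ≤ 1 := by
  have h1 := h (x + g)
  have h2 := hf (x + g) x
  rw [add_sub_cancel_left, real_inner_self_eq_norm_sq] at h1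
  rw [add_sub_cancel_left] at h2
  by_contra hc
  nlinarith

/-- The subdifferential is monotone, so `x` and `g` are both nonexpansive functions
of `x + g`. -/
theorem sq_norm_sub_add_sq_norm_sub_le (h : IsSubgradientAt f x g) (h' : IsSubgradientAt f x' g') :
    ‖x - x'‖ ^ 2 + ‖g - g'‖ ^ 2 ≤ ‖(x + g) - (x' + g')‖ ^ 2 := by
  have h1 := h x'
  have h2 := h' x
  have h3 : (x + g) - (x' + g') = (x - x') + (g - g') := by abel
  rw [h3, norm_add_sq_real]
  have h4 : ⟪x - x', g - g'⟫ = -⟪g, x' - x⟫ - ⟪g', x - x'⟫ := by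
    simp only [inner_sub_left, inner_sub_right, real_inner_comm]; ring
  linarith

theorem norm_sub_le (h : IsSubgradientAt f x g) (h' : IsSubgradientAt f x' g') :
    ‖x - x'‖ ≤ ‖(x + g) - (x' + g')‖ := by
  have := h.sq_norm_sub_add_sq_norm_sub_le h'
  exact abs_le_of_sq_le_sq' (by nlinarith [sq_nonneg ‖g - g'‖]) (norm_nonneg _) |>.2

theorem norm_slope_sub_le (h : IsSubgradientAt f x g) (h' : IsSubgradientAt f x' g') :
    ‖g - g'‖ ≤ ‖(x + g) - (x' + g')‖ := by
  have := h.sq_norm_sub_add_sq_norm_sub_le h'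
  exact abs_le_of_sq_le_sq' (by nlinarith [sq_nonneg ‖x - x'‖]) (norm_nonneg _) |>.2

/-- Supporting affine functions at nearby points of the graph of the subdifferential differ
by a quantity of second order. -/
theorem abs_affine_sub_affine_le (h : IsSubgradientAt f x g) (h' : IsSubgradientAt f x' g')
    {η ρ : ℝ} (hη : ‖(x + g) - (x' + g')‖ ≤ η) {y : E} (hy : ‖y - x‖ ≤ ρ) :
    |(f x + ⟪g, y - x⟫) - (f x' + ⟪g', y - x'⟫)| ≤ η * (η + ρ) := by
  have hx := (h.norm_sub_le h').trans hη
  have hg := (h.norm_slope_sub_le h').trans hη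
  have hη0 : 0 ≤ η := (norm_nonneg _).trans hx
  have h1 := h x'
  have h2 := h' x
  have e : (f x + ⟪g, y - x⟫) - (f x' + ⟪g', y - x'⟫)
      = (f x - f x' - ⟪g', x - x'⟫) + ⟪g - g', y - x⟫ := by
    simp only [inner_sub_left, inner_sub_right]; ring
  have h3 : |f x - f x' - ⟪g', x - x'⟫| ≤ η * η := by
    have h5 : ⟪g - g', x - x'⟫ ≤ η * η :=
      (real_inner_le_norm _ _).trans (mul_le_mul hg hx (norm_nonneg _) hη0)
    have h6 : ⟪g - g', x - x'⟫ = -⟪g, x' - x⟫ - ⟪g', x - x'⟫ := by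
      simp only [inner_sub_left, inner_sub_right]; ring
    rw [abs_of_nonneg (by linarith)]
    linarith
  have h4 : |⟪g - g', y - x⟫| ≤ η * ρ :=
    (abs_real_inner_le_norm _ _).trans (mul_le_mul hg hy (norm_nonneg _) hη0)
  rw [e, mul_add]
  exact (abs_add_le _ _).trans (add_le_add h3 h4)

end IsSubgradientAt

/-- Every point `z` is of the form `x + r • g` with `g` a subgradient at `x`: the point `x` is the
minimizer of `r * f x + ‖x - z‖ ^ 2 / 2`. -/
theorem ConvexOn.exists_isSubgradientAt_add_smul_eq {E : Type*} [NormedAddCommGroup E]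
    [InnerProductSpace ℝ E] [ProperSpace E] {f : E → ℝ} (hc : ConvexOn ℝ univ f)
    (hf : ∀ x y, f x - f y ≤ ‖x - y‖) {r : ℝ} (hr : 0 < r) (z : E) :
    ∃ x g, x + r • g = z ∧ IsSubgradientAt f x g := by
  have hcont : Continuous f := by
    refine (LipschitzWith.of_dist_le_mul (K := 1) fun x y => ?_).continuous
    rw [Real.dist_eq, dist_eq_norm, NNReal.coe_one, one_mul, abs_le]
    have := hf y x
    rw [norm_sub_rev] at this
    exact ⟨by linarith, hf x y⟩
  obtain ⟨x, -, hx⟩ := (isCompact_closedBall z (2 * r)).exists_isMinOn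
    ⟨z, Metric.mem_closedBall_self (by positivity)⟩
    (f := fun x => r * f x + ‖x - z‖ ^ 2 / 2) (by fun_prop)
  have hmin : ∀ y, r * f x + ‖x - z‖ ^ 2 / 2 ≤ r * f y + ‖y - z‖ ^ 2 / 2 := by
    intro y
    by_cases hy : y ∈ Metric.closedBall z (2 * r)
    · exact hx hy
    · have h1 := hx (Metric.mem_closedBall_self (x := z) (by positivity : 0 ≤ 2 * r))
      have h2 := hf z y
      rw [Metric.mem_closedBall, dist_eq_norm, not_le] at hy
      simp only [mem_ofPred_eq, sub_self, norm_zero] at h1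
      rw [norm_sub_rev] at h2
      nlinarith
  refine ⟨x, r⁻¹ • (z - x), by rw [smul_inv_smul₀ hr.ne']; abel, fun w => ?_⟩
  have key : 0 ≤ r * (f w - f x) + ⟪x - z, w - x⟫ := by
    -- compare with the points `x + t • (w - x)` and let `t` tend to `0`
    have h1 : ∀ t : ℝ, 0 < t → t ≤ 1 →
        0 ≤ r * (f w - f x) + ⟪x - z, w - x⟫ + t * (‖w - x‖ ^ 2 / 2) := by
      intro t ht ht1
      have h2 := hmin (x + t • (w - x))
      have h3 := hc.2 (mem_univ x) (mem_univ w) (sub_nonneg.2 ht1) ht.le (by ring)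
      have h4 : (1 - t) • x + t • w = x + t • (w - x) := by module
      have h5 : x + t • (w - x) - z = (x - z) + t • (w - x) := by abel
      rw [h4, smul_eq_mul, smul_eq_mul] at h3
      rw [h5, norm_add_sq_real, inner_smul_right, norm_smul, mul_pow, Real.norm_eq_abs,
        sq_abs] at h2
      have h6 := mul_le_mul_of_nonneg_left h3 hr.le
      have h7 : 0 ≤ t * (r * (f w - f x) + ⟪x - z, w - x⟫ + t * (‖w - x‖ ^ 2 / 2)) := by
        nlinarith
      exact nonneg_of_mul_nonneg_right h7 ht
    by_contra hneg
    push Not at hneg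
    set s := r * (f w - f x) + ⟪x - z, w - x⟫
    set q := ‖w - x‖ ^ 2 / 2
    have hq : 0 ≤ q := by positivity
    have h8 := h1 (min 1 (-s / (q + 1) / 2)) (lt_min one_pos (by
      have : 0 < -s := by linarith
      positivity)) (min_le_left _ _)
    have h9 : min 1 (-s / (q + 1) / 2) * q ≤ -s / (q + 1) / 2 * q :=
      mul_le_mul_of_nonneg_right (min_le_right _ _) hq
    have h10 : -s / (q + 1) * q ≤ -s := by
      rw [div_mul_eq_mul_div, div_le_iff₀ (by positivity)]
      nlinarith
    linarith
  have e : ⟪r⁻¹ • (z - x), w - x⟫ = -(r⁻¹ * ⟪x - z, w - x⟫) := by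
    rw [real_inner_smul_left, ← neg_sub x z, inner_neg_left]; ring
  rw [e]
  have := mul_nonneg (inv_nonneg.2 hr.le) key
  rw [mul_add, inv_mul_cancel_left₀ hr.ne'] at this
  linarith

/-! ### Rounded samples of the graph of the subdifferential -/

/-- The point of the lattice `δ ℤ ^ d` with integer coordinates `X`. -/
def latticePoint {d : ℕ} (δ : ℝ) (X : Fin d → ℤ) : EuclideanSpace ℝ (Fin d) :=
  WithLp.toLp 2 fun i => δ * X i

@[simp]
theorem latticePoint_apply {d : ℕ} (δ : ℝ) (X : Fin d → ℤ) (i : Fin d) :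
    latticePoint δ X i = δ * X i := rfl

theorem inner_latticePoint {d : ℕ} (δ : ℝ) (X Y : Fin d → ℤ) :
    ⟪latticePoint δ Y, latticePoint δ X⟫ = δ ^ 2 * ((∑ i, Y i * X i : ℤ) : ℝ) := by
  rw [PiLp.inner_apply]
  push_cast
  rw [Finset.mul_sum]
  refine Finset.sum_congr rfl fun i _ => ?_
  simp only [latticePoint_apply, RCLike.inner_apply, conj_trivial]
  ring

theorem latticePoint_sub {d : ℕ} (δ : ℝ) (X Y : Fin d → ℤ) :
    latticePoint δ (X - Y) = latticePoint δ X - latticePoint δ Y := by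
  ext i
  simp [mul_sub]

theorem EuclideanSpace.norm_le_card_mul {d : ℕ} {v : EuclideanSpace ℝ (Fin d)} {δ : ℝ}
    (hδ : 0 ≤ δ) (h : ∀ i, |v i| ≤ δ) : ‖v‖ ≤ d * δ := by
  have h1 : ‖v‖ ^ 2 ≤ (d * δ) ^ 2 := by
    rw [EuclideanSpace.norm_sq_eq]
    calc ∑ i, ‖v i‖ ^ 2 ≤ ∑ _i : Fin d, δ ^ 2 :=
          Finset.sum_le_sum fun i _ => pow_le_pow_left₀ (norm_nonneg _) (h i) 2
      _ = d * δ ^ 2 := by simp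
      _ ≤ (d * δ) ^ 2 := by
          rw [mul_pow]
          refine mul_le_mul_of_nonneg_right ?_ (sq_nonneg _)
          exact_mod_cast Nat.le_self_pow two_ne_zero d
  exact abs_le_of_sq_le_sq' h1 (by positivity) |>.2

theorem EuclideanSpace.abs_apply_le_norm {d : ℕ} (v : EuclideanSpace ℝ (Fin d)) (i : Fin d) :
    |v i| ≤ ‖v‖ := PiLp.norm_apply_le v i

theorem abs_sub_mul_floor_div_le {δ : ℝ} (hδ : 0 < δ) (t : ℝ) : |t - δ * ⌊t / δ⌋| ≤ δ := by
  have h1 := Int.floor_le (t / δ)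
  have h2 := Int.lt_floor_add_one (t / δ)
  rw [le_div_iff₀ hδ] at h1
  rw [div_lt_iff₀ hδ] at h2
  rw [abs_le]
  constructor <;> linarith

theorem abs_floor_div_sub_floor_div_le {δ c s t : ℝ} (hδ : 0 < δ) (h : |s - t| ≤ c * δ) :
    |((⌊s / δ⌋ - ⌊t / δ⌋ : ℤ) : ℝ)| ≤ c + 1 := by
  have h1 := Int.floor_le (s / δ)
  have h2 := Int.lt_floor_add_one (s / δ)
  have h3 := Int.floor_le (t / δ)
  have h4 := Int.lt_floor_add_one (t / δ)
  have h5 : |s / δ - t / δ| ≤ c := by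
    rwa [← sub_div, abs_div, abs_of_pos hδ, div_le_iff₀ hδ]
  rw [abs_le] at h5 ⊢
  push_cast
  constructor <;> linarith [h5.1, h5.2]

theorem norm_sub_latticePoint_floor_le {d : ℕ} {δ : ℝ} (hδ : 0 < δ)
    (x : EuclideanSpace ℝ (Fin d)) : ‖x - latticePoint δ fun i => ⌊x i / δ⌋‖ ≤ d * δ :=
  EuclideanSpace.norm_le_card_mul hδ.le fun i => abs_sub_mul_floor_div_le hδ (x i)

/-- The rounded form of a supporting affine function: integer coordinates of the base point,
of the slope, and the integer part of the value. -/
abbrev Sample (d : ℕ) : Type := (Fin d → ℤ) × (Fin d → ℤ) × ℤ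

/-- The sample `p` comes from the point `z` if it is obtained by rounding from the pair `(x, g)`
with `x + g = z` in the graph of the subdifferential of `f`. Base point and slope are rounded to
multiples of `δ`; the value of the affine function at the *rounded* base point is rounded to a
multiple of `δ ^ 2`. -/
def IsSample {d : ℕ} (f : EuclideanSpace ℝ (Fin d) → ℝ) (δ : ℝ) (z : EuclideanSpace ℝ (Fin d))
    (p : Sample d) : Prop :=
  ∃ x g, x + g = z ∧ IsSubgradientAt f x g ∧ p.1 = (fun i => ⌊x i / δ⌋) ∧
    p.2.1 = (fun i => ⌊g i / δ⌋) ∧ p.2.2 = ⌊(f x + ⟪g, latticePoint δ p.1 - x⟫) / δ ^ 2⌋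

/-- The increment from `p` to `q`. The value of `q` is compared with the one which the affine
function of `p` predicts; this prediction is an integer multiple of `δ ^ 2`. -/
def sampleIncrement {d : ℕ} (p q : Sample d) : Sample d :=
  (q.1 - p.1, q.2.1 - p.2.1, q.2.2 - p.2.2 - ∑ i, p.2.1 i * (q.1 - p.1) i)

theorem sampleIncrement_injective {d : ℕ} (p : Sample d) :
    Function.Injective (sampleIncrement p) := by
  intro q q' h
  simp only [sampleIncrement, Prod.mk.injEq] at h
  obtain ⟨h1, h2, h3⟩ := h
  rw [h1] at h3
  exact Prod.ext (sub_left_injective h1) (Prod.ext (sub_left_injective h2) (by linarith))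

/-- The samples all of whose entries are at most `m` in absolute value. -/
noncomputable def sampleBox (d m : ℕ) : Finset (Sample d) :=
  (Fintype.piFinset fun _ => Finset.Icc (-(m : ℤ)) m) ×ˢ
    (Fintype.piFinset fun _ => Finset.Icc (-(m : ℤ)) m) ×ˢ Finset.Icc (-(m : ℤ)) m

theorem mem_sampleBox {d m : ℕ} {p : Sample d} : p ∈ sampleBox d m ↔
    (∀ i, |(p.1 i : ℝ)| ≤ m) ∧ (∀ i, |(p.2.1 i : ℝ)| ≤ m) ∧ |(p.2.2 : ℝ)| ≤ m := by
  have h : ∀ t : ℤ, |(t : ℝ)| ≤ m ↔ -(m : ℤ) ≤ t ∧ t ≤ m := by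
    intro t
    rw [abs_le]
    norm_cast
  simp only [sampleBox, Finset.mem_product, Fintype.mem_piFinset, Finset.mem_Icc, h]

theorem card_sampleBox (d m : ℕ) : (sampleBox d m).card = (2 * m + 1) ^ (2 * d + 1) := by
  have h : (Finset.Icc (-(m : ℤ)) m).card = 2 * m + 1 := by
    rw [Int.card_Icc]; omega
  simp only [sampleBox, Finset.card_product, Fintype.card_piFinset, h, Finset.prod_const,
    Finset.card_univ, Fintype.card_fin]
  ring

section Sample

variable {d : ℕ} {f f' : EuclideanSpace ℝ (Fin d) → ℝ} {δ : ℝ} {z z' : EuclideanSpace ℝ (Fin d)}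
  {p q : Sample d}

theorem exists_isSample (hc : ConvexOn ℝ univ f) (hf : ∀ x y, f x - f y ≤ ‖x - y‖) (δ : ℝ)
    (z : EuclideanSpace ℝ (Fin d)) : ∃ p, IsSample f δ z p := by
  obtain ⟨x, g, hz, hg⟩ := hc.exists_isSubgradientAt_add_smul_eq hf one_pos z
  rw [one_smul] at hz
  exact ⟨(fun i => ⌊x i / δ⌋, fun i => ⌊g i / δ⌋,
    ⌊(f x + ⟪g, latticePoint δ (fun i => ⌊x i / δ⌋) - x⟫) / δ ^ 2⌋), x, g, hz, hg, rfl, rfl, rfl⟩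

/-- Samples at points of distance `O(δ)` differ by an increment bounded in terms of the
dimension only: the resolvent is nonexpansive, and nearby supporting affine functions agree up
to `O(δ ^ 2)`. -/
theorem IsSample.sampleIncrement_mem (hδ : 0 < δ) (hp : IsSample f δ z p) (hq : IsSample f δ z' q)
    (hz : ‖z' - z‖ ≤ d * δ) : sampleIncrement p q ∈ sampleBox d (5 * d ^ 2 + 2) := by
  obtain ⟨x, g, rfl, hg, hp1, hp2, hp3⟩ := hp
  obtain ⟨x', g', rfl, hg', hq1, hq2, hq3⟩ := hq
  have hd : ((d : ℕ) : ℝ) + 1 ≤ ((5 * d ^ 2 + 2 : ℕ) : ℝ) := by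
    have : d + 1 ≤ 5 * d ^ 2 + 2 := by nlinarith [Nat.le_self_pow two_ne_zero d]
    exact_mod_cast this
  have hxx := (hg'.norm_sub_le hg).trans hz
  have hgg := (hg'.norm_slope_sub_le hg).trans hz
  have hx := norm_sub_latticePoint_floor_le hδ x
  have hx' := norm_sub_latticePoint_floor_le hδ x'
  have hG := norm_sub_latticePoint_floor_le hδ g
  rw [← hp1] at hx
  rw [← hq1] at hx'
  rw [← hp2] at hG
  refine mem_sampleBox.2 ⟨fun i => ?_, fun i => ?_, ?_⟩
  · refine le_trans ?_ hd
    simp only [sampleIncrement, hp1, hq1, Pi.sub_apply]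
    exact abs_floor_div_sub_floor_div_le hδ
      ((EuclideanSpace.abs_apply_le_norm (x' - x) i).trans hxx)
  · refine le_trans ?_ hd
    simp only [sampleIncrement, hp2, hq2, Pi.sub_apply]
    exact abs_floor_div_sub_floor_div_le hδ
      ((EuclideanSpace.abs_apply_le_norm (g' - g) i).trans hgg)
  · set a := latticePoint δ p.1 with ha
    set b := latticePoint δ q.1 with hb
    set h := latticePoint δ p.2.1 with hh
    have hη : 0 ≤ (d : ℝ) * δ := by positivity
    have h1 : |(f x' + ⟪g', b - x'⟫) - (f x + ⟪g, b - x⟫)| ≤ d * δ * (d * δ + d * δ) :=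
      hg'.abs_affine_sub_affine_le hg hz (by rwa [norm_sub_rev])
    have hba : ‖b - a‖ ≤ 3 * (d * δ) := by
      have : b - a = (x' - x) + (x - a) - (x' - b) := by abel
      rw [this]
      refine (norm_sub_le _ _).trans ?_
      have := norm_add_le (x' - x) (x - a)
      linarith
    have h2 : |⟪g - h, b - a⟫| ≤ d * δ * (3 * (d * δ)) :=
      (abs_real_inner_le_norm _ _).trans (mul_le_mul hG hba (norm_nonneg _) hη)
    have h3 : ⟪h, b - a⟫ = δ ^ 2 * ((∑ i, p.2.1 i * (q.1 - p.1) i : ℤ) : ℝ) := by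
      rw [hb, ha, ← latticePoint_sub, inner_latticePoint]
    set S : ℤ := ∑ i, p.2.1 i * (q.1 - p.1) i with hS
    have h4 : |(f x' + ⟪g', b - x'⟫) / δ ^ 2 - (f x + ⟪g, a - x⟫) / δ ^ 2 - S| ≤ 5 * d ^ 2 := by
      have hδ2 : 0 < δ ^ 2 := by positivity
      have e : (f x' + ⟪g', b - x'⟫) / δ ^ 2 - (f x + ⟪g, a - x⟫) / δ ^ 2 - S
          = (((f x' + ⟪g', b - x'⟫) - (f x + ⟪g, b - x⟫)) + ⟪g - h, b - a⟫) / δ ^ 2 := by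
        have e1 : ⟪g - h, b - a⟫ = ⟪g, b - x⟫ - ⟪g, a - x⟫ - ⟪h, b - a⟫ := by
          simp only [inner_sub_left, inner_sub_right]; ring
        rw [e1, h3]
        field_simp
        ring
      rw [e, abs_div, abs_of_pos hδ2, div_le_iff₀ hδ2]
      refine (abs_add_le _ _).trans ((add_le_add h1 h2).trans (le_of_eq ?_))
      ring
    have e5 : (sampleIncrement p q).2.2 = q.2.2 - p.2.2 - S := rfl
    rw [e5, hp3, hq3]
    have h6 := Int.floor_le ((f x' + ⟪g', b - x'⟫) / δ ^ 2)
    have h7 := Int.lt_floor_add_one ((f x' + ⟪g', b - x'⟫) / δ ^ 2)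
    have h8 := Int.floor_le ((f x + ⟪g, a - x⟫) / δ ^ 2)
    have h9 := Int.lt_floor_add_one ((f x + ⟪g, a - x⟫) / δ ^ 2)
    rw [abs_le] at h4 ⊢
    push_cast
    constructor <;> linarith [h4.1, h4.2]

theorem abs_sub_le_of_floor_div_eq {s t : ℝ} (hδ : 0 < δ) (h : ⌊s / δ⌋ = ⌊t / δ⌋) :
    |s - t| ≤ δ := by
  have h1 := Int.abs_sub_lt_one_of_floor_eq_floor h
  rw [← sub_div, abs_div, abs_of_pos hδ, div_lt_iff₀ hδ, one_mul] at h1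
  exact h1.le

/-- If `f` and `f'` have the same sample at `z`, then `f'` is not much smaller than `f` at base
points of subgradients of `f` belonging to points close to `z`. -/
theorem IsSample.le_add_of_isSubgradientAt (hδ : 0 < δ) (hp : IsSample f δ z p)
    (hp' : IsSample f' δ z p) {u v : EuclideanSpace ℝ (Fin d)} (huv : IsSubgradientAt f u v)
    (hz : ‖u + v - z‖ ≤ d * δ) : f u ≤ f' u + (3 * d ^ 2 + 1) * δ ^ 2 := by
  obtain ⟨x, g, rfl, hg, hp1, hp2, hp3⟩ := hp
  obtain ⟨x', g', -, hg', hp1', hp2', hp3'⟩ := hp'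
  have hη : 0 ≤ (d : ℝ) * δ := by positivity
  set a := latticePoint δ p.1 with ha
  have h1 := huv.abs_affine_sub_affine_le hg hz (y := u) (ρ := 0) (by simp)
  have hgg : ‖g - g'‖ ≤ d * δ := EuclideanSpace.norm_le_card_mul hδ.le fun i =>
    abs_sub_le_of_floor_div_eq hδ (congrFun (hp2.symm.trans hp2') i)
  have hx := norm_sub_latticePoint_floor_le hδ x
  rw [← hp1, ← ha] at hx
  have hua : ‖u - a‖ ≤ 2 * (d * δ) := by
    have h2 := (huv.norm_sub_le hg).trans hz
    have : u - a = (u - x) + (x - a) := by abel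
    rw [this]
    refine (norm_add_le _ _).trans ?_
    linarith
  have h3 : |⟪g - g', u - a⟫| ≤ d * δ * (2 * (d * δ)) :=
    (abs_real_inner_le_norm _ _).trans (mul_le_mul hgg hua (norm_nonneg _) hη)
  have h4 := abs_sub_le_of_floor_div_eq (by positivity : 0 < δ ^ 2) (hp3.symm.trans hp3')
  have h5 := hg' u
  have e : f x + ⟪g, u - x⟫ - (f' x' + ⟪g', u - x'⟫)
      = (f x + ⟪g, a - x⟫ - (f' x' + ⟪g', a - x'⟫)) + ⟪g - g', u - a⟫ := by
    simp only [inner_sub_left, inner_sub_right]; ring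
  rw [sub_self, inner_zero_right, add_zero, add_zero] at h1
  rw [abs_le] at h1 h3 h4
  nlinarith [h1.2, h3.2, h4.2]

/-- The entries of a sample are bounded by a multiple of `1 / δ ^ 2`, for a function `f` as in the
normalized class and `z` in a bounded region. -/
theorem IsSample.mem_sampleBox (hδ : 0 < δ) (hδ1 : δ ≤ 1) (hf : ∀ x y, f x - f y ≤ ‖x - y‖)
    (hf0 : |f 0| ≤ 1) {R : ℝ} (hz : ‖z‖ ≤ R) (hp : IsSample f δ z p) {m : ℕ}
    (hm : (R + d + 3) / δ ^ 2 ≤ m) : p ∈ sampleBox d m := by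
  obtain ⟨x, g, rfl, hg, hp1, hp2, hp3⟩ := hp
  have hg1 := hg.norm_le_one hf
  have hx : ‖x‖ ≤ R + 1 := by
    have : x = (x + g) - g := by abel
    rw [this]
    exact (norm_sub_le _ _).trans (by linarith)
  have hR : 0 ≤ R := (norm_nonneg _).trans hz
  have hδ2 : 0 < δ ^ 2 := by positivity
  have hδ2' : δ ^ 2 ≤ 1 := pow_le_one₀ hδ.le hδ1
  have floor_bound : ∀ {t : ℝ}, |t| ≤ R + d + 2 → |((⌊t / δ ^ 2⌋ : ℤ) : ℝ)| ≤ m := by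
    intro t ht
    have h1 : |t / δ ^ 2| ≤ (R + d + 2) / δ ^ 2 := by
      rw [abs_div, abs_of_pos hδ2]
      exact div_le_div_of_nonneg_right ht hδ2.le
    have h2 : (1 : ℝ) ≤ 1 / δ ^ 2 := by rwa [le_div_iff₀ hδ2, one_mul]
    have h3 : (R + d + 3) / δ ^ 2 = (R + d + 2) / δ ^ 2 + 1 / δ ^ 2 := by ring
    have h4 := Int.floor_le (t / δ ^ 2)
    have h5 := Int.lt_floor_add_one (t / δ ^ 2)
    rw [abs_le] at h1 ⊢
    constructor <;> linarith [h1.1, h1.2]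
  have floor_bound' : ∀ {t : ℝ}, |t| ≤ R + 1 → |((⌊t / δ⌋ : ℤ) : ℝ)| ≤ m := by
    intro t ht
    have e : t / δ = (t * δ) / δ ^ 2 := by field_simp
    rw [e]
    refine floor_bound ?_
    rw [abs_mul, abs_of_pos hδ]
    have : |t| * δ ≤ |t| * 1 := mul_le_mul_of_nonneg_left hδ1 (abs_nonneg _)
    have hd : (0 : ℝ) ≤ d := Nat.cast_nonneg d
    linarith
  refine _root_.mem_sampleBox.2 ⟨fun i => ?_, fun i => ?_, ?_⟩
  · rw [hp1]
    exact floor_bound' ((EuclideanSpace.abs_apply_le_norm x i).trans hx)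
  · rw [hp2]
    exact floor_bound' (((EuclideanSpace.abs_apply_le_norm g i).trans hg1).trans (by linarith))
  · rw [hp3, hp1]
    have h1 := norm_sub_latticePoint_floor_le hδ x
    set a := latticePoint δ fun i => ⌊x i / δ⌋
    have h2 : |⟪g, a - x⟫| ≤ 1 * (d * δ) :=
      (abs_real_inner_le_norm _ _).trans
        (mul_le_mul hg1 (by rwa [norm_sub_rev]) (norm_nonneg _) zero_le_one)
    have h3 : (d : ℝ) * δ ≤ d * 1 := mul_le_mul_of_nonneg_left hδ1 (Nat.cast_nonneg d)
    have h4 := hf x 0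
    have h5 := hf 0 x
    rw [sub_zero] at h4
    rw [zero_sub, norm_neg] at h5
    refine floor_bound ?_
    rw [abs_le] at *
    constructor <;> linarith [hf0.1, hf0.2, h2.1, h2.2]

end Sample

/-! ### Encoding normalized convex functions -/

/-- Convex functions on the whole space, nonexpansive for the Euclidean norm and bounded by `1`
at the origin. -/
def normalizedClass (d : ℕ) : Set (EuclideanSpace ℝ (Fin d) → ℝ) :=
  {f | ConvexOn ℝ univ f ∧ (∀ x y, f x - f y ≤ ‖x - y‖) ∧ |f 0| ≤ 1}

/-- The points of a grid of mesh `δ` with lowest corner `(-3, …, -3)`. The sums `x + g` of points `x`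
at distance at most `1` from the unit cube and of subgradients `g`, of norm at most `1`, have
entries in `[-3, 3]`. -/
def gridPoint {d : ℕ} (δ : ℝ) (k : Fin d → ℕ) : EuclideanSpace ℝ (Fin d) :=
  WithLp.toLp 2 fun i => δ * k i - 3

@[simp]
theorem gridPoint_apply {d : ℕ} (δ : ℝ) (k : Fin d → ℕ) (i : Fin d) :
    gridPoint δ k i = δ * k i - 3 := rfl

/-- The predecessor `k - 1` (truncated subtraction in all coordinates) makes the grid a tree with
root `0`. -/
theorem norm_gridPoint_sub_gridPoint_pred_le {d : ℕ} {δ : ℝ} (hδ : 0 ≤ δ) (k : Fin d → ℕ) :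
    ‖gridPoint δ k - gridPoint δ (k - 1)‖ ≤ d * δ := by
  refine EuclideanSpace.norm_le_card_mul hδ fun i => ?_
  rw [PiLp.sub_apply, gridPoint_apply, gridPoint_apply, Pi.sub_apply, Pi.one_apply]
  rcases Nat.eq_zero_or_pos (k i) with h | h
  · simp [h, hδ]
  · rw [Nat.cast_sub (show 1 ≤ k i from h), Nat.cast_one]
    have : δ * (k i : ℝ) - 3 - (δ * ((k i : ℝ) - 1) - 3) = δ := by ring
    rw [this, abs_of_nonneg hδ]

theorem exists_gridPoint_near {d : ℕ} {δ : ℝ} (hδ : 0 < δ) {z : EuclideanSpace ℝ (Fin d)}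
    (hz : ∀ i, |z i| ≤ 3) :
    ∃ k : Fin d → ℕ, (∀ i, k i ≤ ⌊6 / δ⌋₊) ∧ ‖z - gridPoint δ k‖ ≤ d * δ := by
  refine ⟨fun i => ⌊(z i + 3) / δ⌋₊, fun i => ?_, ?_⟩
  · refine Nat.floor_le_floor (div_le_div_of_nonneg_right ?_ hδ.le)
    linarith [(abs_le.1 (hz i)).2]
  · refine EuclideanSpace.norm_le_card_mul hδ.le fun i => ?_
    rw [PiLp.sub_apply, gridPoint_apply]
    have h0 : 0 ≤ (z i + 3) / δ := div_nonneg (by linarith [(abs_le.1 (hz i)).1]) hδ.le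
    have h1 := Nat.floor_le h0
    have h2 := Nat.lt_floor_add_one ((z i + 3) / δ)
    rw [le_div_iff₀ hδ] at h1
    rw [div_lt_iff₀ hδ] at h2
    rw [abs_le]
    constructor <;> linarith

/-- Samples on the grid are determined by the one at the root and the increments. -/
theorem samples_eq_of_sampleIncrement_eq {d n : ℕ} {D D' : (Fin d → ℕ) → Sample d}
    (h0 : D 0 = D' 0)
    (h : ∀ k : Fin d → ℕ, (∀ i, k i ≤ n) →
      sampleIncrement (D (k - 1)) (D k) = sampleIncrement (D' (k - 1)) (D' k))
    (k : Fin d → ℕ) (hk : ∀ i, k i ≤ n) : D k = D' k := by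
  have key : ∀ m ≤ n, ∀ k : Fin d → ℕ, (∀ i, k i ≤ m) → D k = D' k := by
    intro m
    induction m with
    | zero =>
      intro _ k hk
      have : k = 0 := funext fun i => Nat.le_zero.1 (hk i)
      rw [this, h0]
    | succ m ih =>
      intro hm k hk
      have h1 := ih (by omega) (k - 1) fun i => by
        have := hk i
        simp only [Pi.sub_apply, Pi.one_apply]
        omega
      have h2 := h k fun i => (hk i).trans hm
      rw [h1] at h2
      exact sampleIncrement_injective _ h2
  exact key n le_rfl k hk

/-- Two functions of the normalized class with the same samples on the grid are close to each
other on the unit cube. A point of the cube is first moved by at most `δ ^ 2` to the base point of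
a subgradient. -/
theorem le_add_of_isSample {d : ℕ} {δ : ℝ} (hδ : 0 < δ) (hδ1 : δ ≤ 1)
    {f f' : EuclideanSpace ℝ (Fin d) → ℝ} (hf : f ∈ normalizedClass d)
    (hf' : f' ∈ normalizedClass d) {D : (Fin d → ℕ) → Sample d}
    (h : ∀ k, (∀ i, k i ≤ ⌊6 / δ⌋₊) →
      IsSample f δ (gridPoint δ k) (D k) ∧ IsSample f' δ (gridPoint δ k) (D k))
    {x : EuclideanSpace ℝ (Fin d)} (hx : ∀ i, x i ∈ Icc (0 : ℝ) 1) :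
    f x ≤ f' x + (3 * d ^ 2 + 3) * δ ^ 2 := by
  have hδ2 : 0 < δ ^ 2 := by positivity
  have hδ2' : δ ^ 2 ≤ 1 := pow_le_one₀ hδ.le hδ1
  obtain ⟨u, v, huv, hv⟩ := hf.1.exists_isSubgradientAt_add_smul_eq hf.2.1 hδ2 x
  have hv1 := hv.norm_le_one hf.2.1
  have hxu : ‖x - u‖ ≤ δ ^ 2 := by
    rw [← huv, add_sub_cancel_left, norm_smul, Real.norm_eq_abs, abs_of_pos hδ2]
    exact mul_le_of_le_one_right hδ2.le hv1
  obtain ⟨k, hk, hkz⟩ := exists_gridPoint_near hδ (z := u + v) fun i => by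
    have h1 := (EuclideanSpace.abs_apply_le_norm (x - u) i).trans hxu
    have h2 := (EuclideanSpace.abs_apply_le_norm v i).trans hv1
    rw [PiLp.sub_apply] at h1
    rw [PiLp.add_apply]
    rw [abs_le] at *
    obtain ⟨h3, h4⟩ := hx i
    constructor <;> linarith [h1.1, h1.2, h2.1, h2.2]
  have h1 := (h k hk).1.le_add_of_isSubgradientAt hδ (h k hk).2 hv hkz
  have h2 := hf.2.1 x u
  have h3 := hf'.2.1 u x
  rw [norm_sub_rev] at h3
  linarith

theorem card_code_le {d : ℕ} (hd : 1 ≤ d) {δ : ℝ} (hδ : 0 < δ) (hδ1 : δ ≤ 1) :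
    (((2 * ⌈(3 * d + d + 3) / δ ^ 2⌉₊ + 1) ^ (2 * d + 1) *
      ((2 * (5 * d ^ 2 + 2) + 1) ^ (2 * d + 1)) ^ (⌊6 / δ⌋₊ + 1) ^ d : ℕ) : ℝ) ≤
    Real.exp (((2 * d + 1) * ((8 * d + 11) + (10 * d ^ 2 + 5) * 7 ^ d)) * (1 / δ) ^ d) := by
  have h1δ : (1 : ℝ) ≤ 1 / δ := by rwa [le_div_iff₀ hδ, one_mul]
  have hpow : 1 / δ ≤ (1 / δ) ^ d := le_self_pow₀ h1δ (by omega)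
  have hpow1 : 1 ≤ (1 / δ) ^ d := h1δ.trans hpow
  have hdn : (0 : ℝ) ≤ d := Nat.cast_nonneg d
  have hle : ∀ t : ℝ, t ≤ Real.exp t := fun t => by linarith [Real.add_one_le_exp t]
  have hroot : ((2 * ⌈(3 * d + d + 3) / δ ^ 2⌉₊ + 1 : ℕ) : ℝ) ≤
      Real.exp ((8 * d + 11) * (1 / δ) ^ d) := by
    have h1 := Nat.ceil_lt_add_one (a := (3 * d + d + 3) / δ ^ 2) (by positivity)
    have h2 : (1 : ℝ) ≤ (1 / δ) ^ 2 := one_le_pow₀ h1δ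
    have h3 : (3 * d + d + 3) / δ ^ 2 = (4 * d + 3) * (1 / δ) ^ 2 := by
      rw [div_pow, one_pow]; ring
    calc ((2 * ⌈(3 * d + d + 3) / δ ^ 2⌉₊ + 1 : ℕ) : ℝ)
        ≤ (8 * d + 9) * (1 / δ) ^ 2 := by
          push_cast
          nlinarith
      _ ≤ Real.exp (8 * d + 9) * (Real.exp (1 / δ)) ^ 2 := by
          gcongr <;> exact hle _
      _ = Real.exp (8 * d + 9 + 2 * (1 / δ)) := by
          rw [← Real.exp_nat_mul, ← Real.exp_add]
          norm_num
      _ ≤ _ := by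
          refine Real.exp_le_exp.2 ?_
          nlinarith
  have hn : ((⌊6 / δ⌋₊ + 1 : ℕ) : ℝ) ≤ 7 * (1 / δ) := by
    have h1 := Nat.floor_le (a := 6 / δ) (by positivity)
    have h2 : 6 / δ = 6 * (1 / δ) := by ring
    push_cast
    linarith
  have hinc : ((2 * (5 * d ^ 2 + 2) + 1 : ℕ) : ℝ) ≤ Real.exp (10 * d ^ 2 + 5) := by
    refine le_trans (le_of_eq ?_) (hle _)
    push_cast
    ring
  have hnd : (((⌊6 / δ⌋₊ + 1) ^ d : ℕ) : ℝ) ≤ 7 ^ d * (1 / δ) ^ d := by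
    rw [← mul_pow, Nat.cast_pow]
    exact pow_le_pow_left₀ (Nat.cast_nonneg _) hn d
  rw [Nat.cast_mul, Nat.cast_pow, Nat.cast_pow, Nat.cast_pow, ← pow_mul]
  calc _ ≤ Real.exp ((8 * d + 11) * (1 / δ) ^ d) ^ (2 * d + 1) *
        Real.exp (10 * d ^ 2 + 5) ^ ((2 * d + 1) * (⌊6 / δ⌋₊ + 1) ^ d) := by gcongr
    _ = Real.exp ((2 * d + 1 : ℕ) * ((8 * d + 11) * (1 / δ) ^ d) +
        ((2 * d + 1 : ℕ) * ((⌊6 / δ⌋₊ + 1) ^ d : ℕ)) * (10 * d ^ 2 + 5)) := by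
        rw [← Real.exp_nat_mul, ← Real.exp_nat_mul, ← Real.exp_add, ← Nat.cast_mul]
    _ ≤ _ := by
        refine Real.exp_le_exp.2 ?_
        have : ((2 * d + 1 : ℕ) * ((⌊6 / δ⌋₊ + 1) ^ d : ℕ) : ℝ) * (10 * d ^ 2 + 5) ≤
            ((2 * d + 1 : ℕ) * (7 ^ d * (1 / δ) ^ d)) * (10 * d ^ 2 + 5) := by gcongr
        refine (add_le_add_right this _).trans (le_of_eq ?_)
        push_cast
        ring

/-- The entropy bound of Bronshtein for the normalized class, on the unit cube: functions are
encoded by `exp (C * (1 / δ) ^ d)` values such that equality of codes implies uniform distance at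
most `C * δ ^ 2`. -/
theorem exists_code_normalizedClass {d : ℕ} (hd : 1 ≤ d) : ∃ C : ℝ, 1 ≤ C ∧ ∀ δ : ℝ, 0 < δ →
    δ ≤ 1 → ∃ (T : Type) (S : Finset T) (code : (EuclideanSpace ℝ (Fin d) → ℝ) → T),
      (S.card : ℝ) ≤ Real.exp (C * (1 / δ) ^ d) ∧ (∀ f ∈ normalizedClass d, code f ∈ S) ∧
      ∀ f ∈ normalizedClass d, ∀ f' ∈ normalizedClass d, code f = code f' →
        ∀ x : EuclideanSpace ℝ (Fin d), (∀ i, x i ∈ Icc (0 : ℝ) 1) →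
          |f x - f' x| ≤ C * δ ^ 2 := by
  classical
  have h7 : (1 : ℝ) ≤ 7 ^ d := one_le_pow₀ (by norm_num)
  have hdn : (0 : ℝ) ≤ d := Nat.cast_nonneg d
  have hC : (3 * d ^ 2 + 3 : ℝ) ≤ (2 * d + 1) * ((8 * d + 11) + (10 * d ^ 2 + 5) * 7 ^ d) := by
    have h1 : (10 * d ^ 2 + 5 : ℝ) * 1 ≤ (10 * d ^ 2 + 5) * 7 ^ d := by gcongr
    nlinarith [sq_nonneg (d : ℝ)]
  refine ⟨_, le_trans (by nlinarith [sq_nonneg (d : ℝ)]) hC, fun δ hδ hδ1 => ?_⟩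
  set n := ⌊6 / δ⌋₊ with hn
  have hex : ∀ f : EuclideanSpace ℝ (Fin d) → ℝ, ∃ D : (Fin d → ℕ) → Sample d,
      f ∈ normalizedClass d → ∀ k, IsSample f δ (gridPoint δ k) (D k) := by
    intro f
    by_cases hf : f ∈ normalizedClass d
    · choose D hD using fun k : Fin d → ℕ => exists_isSample hf.1 hf.2.1 δ (gridPoint δ k)
      exact ⟨D, fun _ => hD⟩
    · exact ⟨fun _ => 0, fun h => absurd h hf⟩
  choose D hD using hex
  -- the code consists of the sample at the root and of the increments at all grid points
  refine ⟨Sample d × ((Fin d → Fin (n + 1)) → Sample d),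
    sampleBox d ⌈(3 * d + d + 3) / δ ^ 2⌉₊ ×ˢ
      Fintype.piFinset fun _ => sampleBox d (5 * d ^ 2 + 2),
    fun f => (D f 0, fun k => sampleIncrement (D f ((fun i => (k i : ℕ)) - 1))
      (D f fun i => k i)), ?_, ?_, ?_⟩
  · refine le_trans (le_of_eq ?_) (card_code_le hd hδ hδ1)
    simp only [Finset.card_product, Fintype.card_piFinset, card_sampleBox, Finset.prod_const,
      Finset.card_univ, Fintype.card_fun, Fintype.card_fin, hn]
  · intro f hf
    refine Finset.mem_product.2 ⟨?_, Fintype.mem_piFinset.2 fun k => ?_⟩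
    · refine (hD f hf 0).mem_sampleBox hδ hδ1 hf.2.1 hf.2.2 (R := 3 * d) ?_ (Nat.le_ceil _)
      rw [mul_comm]
      refine EuclideanSpace.norm_le_card_mul (by norm_num) fun i => ?_
      simp
    · exact (hD f hf _).sampleIncrement_mem hδ (hD f hf _)
        (norm_gridPoint_sub_gridPoint_pred_le hδ.le _)
  · intro f hf f' hf' hcode x hx
    obtain ⟨h0, h1⟩ := Prod.mk.inj hcode
    have hDD : ∀ k : Fin d → ℕ, (∀ i, k i ≤ n) → D f k = D f' k :=
      samples_eq_of_sampleIncrement_eq h0 fun k hk =>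
        congrFun h1 fun i => ⟨k i, Nat.lt_succ_of_le (hk i)⟩
    have h2 := le_add_of_isSample hδ hδ1 hf hf' (D := D f)
      (fun k hk => ⟨hD f hf k, hDD k hk ▸ hD f' hf' k⟩) hx
    have h3 := le_add_of_isSample hδ hδ1 hf' hf (D := D f)
      (fun k hk => ⟨hDD k hk ▸ hD f' hf' k, hD f hf k⟩) hx
    refine le_trans ?_ (mul_le_mul_of_nonneg_right hC (sq_nonneg δ))
    rw [abs_le]
    constructor <;> linarith

/-! ### Bracketing numbers from encodings -/

theorem bracketingNumber_le_card {d : ℕ} {D : Set (Fin d → ℝ)} {F : Set ((Fin d → ℝ) → ℝ)}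
    {small : ((Fin d → ℝ) → ℝ) → ((Fin d → ℝ) → ℝ) → Prop} {T : Type*} (S : Finset T)
    (l u : T → (Fin d → ℝ) → ℝ) (hlu : ∀ s ∈ S, (∀ x ∈ D, l s x ≤ u s x) ∧ small (l s) (u s))
    (hF : ∀ f ∈ F, ∃ s ∈ S, ∀ x ∈ D, l s x ≤ f x ∧ f x ≤ u s x) :
    bracketingNumber D F small ≤ S.card := by
  refine sInf_le ⟨S.card, rfl, fun i => l (S.equivFin.symm i), fun i => u (S.equivFin.symm i),
    fun i => hlu _ (S.equivFin.symm i).2, fun f hf => ?_⟩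
  obtain ⟨s, hs, h⟩ := hF f hf
  exact ⟨S.equivFin ⟨s, hs⟩, by simpa using h⟩

/-- Bracketing numbers compare if every bracket for `F'` on `D'` can be turned into one bracket
for `F` on `D` which contains all members of `F` that the given one contains. -/
theorem bracketingNumber_le_bracketingNumber {d : ℕ} {D D' : Set (Fin d → ℝ)}
    {F F' : Set ((Fin d → ℝ) → ℝ)}
    {small small' : ((Fin d → ℝ) → ℝ) → ((Fin d → ℝ) → ℝ) → Prop}
    (hFF : F ⊆ F') (h : ∀ l u, (∀ x ∈ D', l x ≤ u x) → small' l u →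
      ∃ l₁ u₁, (∀ x ∈ D, l₁ x ≤ u₁ x) ∧ small l₁ u₁ ∧ ∀ f ∈ F,
        (∀ x ∈ D', l x ≤ f x ∧ f x ≤ u x) → ∀ x ∈ D, l₁ x ≤ f x ∧ f x ≤ u₁ x) :
    bracketingNumber D F small ≤ bracketingNumber D' F' small' := by
  refine sInf_le_sInf ?_
  rintro N ⟨n, rfl, l, u, hlu, hF⟩
  choose l₁ u₁ h1 h2 h3 using fun i => h (l i) (u i) (hlu i).1 (hlu i).2
  refine ⟨n, rfl, l₁, u₁, fun i => ⟨h1 i, h2 i⟩, fun f hf => ?_⟩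
  obtain ⟨i, hi⟩ := hF f (hFF hf)
  exact ⟨i, h3 i f hf hi⟩

theorem log_bracketingNumber_le {N : ℕ∞} {n : ℕ} (hN : N ≤ n) {c : ℝ}
    (hn : (n : ℝ) ≤ Real.exp c) : ENNReal.log (N : ℝ≥0∞) ≤ (c : EReal) := by
  have h1 : (N : ℝ≥0∞) ≤ ENNReal.ofReal (Real.exp c) := by
    calc (N : ℝ≥0∞) ≤ ((n : ℕ∞) : ℝ≥0∞) := by exact_mod_cast hN
      _ = ENNReal.ofReal (n : ℝ) := by simp
      _ ≤ _ := ENNReal.ofReal_le_ofReal hn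
  refine (ENNReal.log_monotone h1).trans (le_of_eq ?_)
  rw [ENNReal.log_ofReal_of_pos (Real.exp_pos c), Real.log_exp]

/-- If functions with the same code are uniformly close, the number of codes bounds the bracketing
number for the supremum norm. -/
theorem bracketingNumber_sup_le_card_of_code {d : ℕ} {D : Set (Fin d → ℝ)}
    {F : Set ((Fin d → ℝ) → ℝ)} {ε : ℝ} (hε : 0 ≤ ε) {T : Type*} (S : Finset T)
    (code : ((Fin d → ℝ) → ℝ) → T) (hS : ∀ f ∈ F, code f ∈ S)
    (h : ∀ f ∈ F, ∀ f' ∈ F, code f = code f' → ∀ x ∈ D, |f x - f' x| ≤ ε / 2) :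
    bracketingNumber D F (fun l u => ∀ x ∈ D, |u x - l x| ≤ ε) ≤ S.card := by
  have hrep : ∀ s, ∃ r : (Fin d → ℝ) → ℝ, (∃ f ∈ F, code f = s) → r ∈ F ∧ code r = s := by
    intro s
    by_cases hs : ∃ f ∈ F, code f = s
    · exact ⟨hs.choose, fun _ => hs.choose_spec⟩
    · exact ⟨0, fun h => absurd h hs⟩
  -- the bracket of a code is centered at a function with this code
  choose r hr using hrep
  refine bracketingNumber_le_card S (fun s x => r s x - ε / 2) (fun s x => r s x + ε / 2)
    (fun s _ => ⟨fun x _ => by linarith, fun x _ => ?_⟩)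
    fun f hf => ⟨code f, hS f hf, fun x hx => ?_⟩
  · rw [add_sub_sub_cancel, add_halves, abs_of_nonneg hε]
  · obtain ⟨h1, h2⟩ := hr (code f) ⟨f, hf, rfl⟩
    have h3 := abs_le.1 (h _ h1 f hf h2 x hx)
    constructor <;> linarith [h3.1, h3.2]

/-! ### Extension of Lipschitz convex functions and normalization -/

/-- The largest function which is Lipschitz with constants `Γ` along the axes and bounded by `φ`
on `D` (meaningful if `D` is nonempty and `φ` bounded below on `D`). -/
noncomputable def lipExtension {d : ℕ} (D : Set (Fin d → ℝ)) (Γ : Fin d → ℝ)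
    (φ : (Fin d → ℝ) → ℝ) (y : Fin d → ℝ) : ℝ :=
  ⨅ x : D, φ x + ∑ i, Γ i * |y i - (x : Fin d → ℝ) i|

section Extension

variable {d : ℕ} {D : Set (Fin d → ℝ)} {B : ℝ} {Γ : Fin d → ℝ} {φ : (Fin d → ℝ) → ℝ}

theorem lipExtension_le (hΓ : ∀ i, 0 ≤ Γ i) (hB : ∀ x ∈ D, |φ x| ≤ B) {x : Fin d → ℝ} (hx : x ∈ D)
    (y : Fin d → ℝ) : lipExtension D Γ φ y ≤ φ x + ∑ i, Γ i * |y i - x i| := by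
  refine ciInf_le ⟨-B, ?_⟩ (⟨x, hx⟩ : D)
  rintro _ ⟨x, rfl⟩
  have h1 := (abs_le.1 (hB x x.2)).1
  have h2 : 0 ≤ ∑ i, Γ i * |y i - (x : Fin d → ℝ) i| :=
    Finset.sum_nonneg fun i _ => mul_nonneg (hΓ i) (abs_nonneg _)
  dsimp only
  linarith

theorem le_lipExtension (hD : D.Nonempty) {y : Fin d → ℝ} {t : ℝ}
    (h : ∀ x ∈ D, t ≤ φ x + ∑ i, Γ i * |y i - x i|) : t ≤ lipExtension D Γ φ y :=
  have := hD.to_subtype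
  le_ciInf fun x => h x x.2

theorem lipExtension_sub_le (hD : D.Nonempty) (hΓ : ∀ i, 0 ≤ Γ i) (hB : ∀ x ∈ D, |φ x| ≤ B)
    (y y' : Fin d → ℝ) :
    lipExtension D Γ φ y - lipExtension D Γ φ y' ≤ ∑ i, Γ i * |y i - y' i| := by
  rw [sub_le_comm]
  refine le_lipExtension hD fun x hx => ?_
  have h1 := lipExtension_le hΓ hB hx y
  have h2 : ∑ i, Γ i * |y i - x i| ≤ ∑ i, Γ i * |y i - y' i| + ∑ i, Γ i * |y' i - x i| := by
    rw [← Finset.sum_add_distrib]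
    refine Finset.sum_le_sum fun i _ => ?_
    rw [← mul_add]
    exact mul_le_mul_of_nonneg_left (abs_sub_le _ _ _) (hΓ i)
  linarith

theorem lipExtension_eq (hΓ : ∀ i, 0 ≤ Γ i) (hφ : φ ∈ jointLipClass D B Γ) {x : Fin d → ℝ}
    (hx : x ∈ D) : lipExtension D Γ φ x = φ x := by
  refine le_antisymm ?_ (le_lipExtension ⟨x, hx⟩ fun y hy => ?_)
  · simpa using lipExtension_le hΓ hφ.1.2.1 hx x
  · linarith [(abs_le.1 (hφ.2 x hx y hy)).2]

theorem convexOn_lipExtension (hD : D.Nonempty) (hΓ : ∀ i, 0 ≤ Γ i) (hφ : ConvexOn ℝ D φ)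
    (hB : ∀ x ∈ D, |φ x| ≤ B) : ConvexOn ℝ univ (lipExtension D Γ φ) := by
  refine ⟨convex_univ, fun y _ y' _ s t hs ht hst => ?_⟩
  have key : ∀ x ∈ D, ∀ x' ∈ D, lipExtension D Γ φ (s • y + t • y') ≤
      s * (φ x + ∑ i, Γ i * |y i - x i|) + t * (φ x' + ∑ i, Γ i * |y' i - x' i|) := by
    intro x hx x' hx'
    refine (lipExtension_le hΓ hB (hφ.1 hx hx' hs ht hst) _).trans ?_
    have h1 := hφ.2 hx hx' hs ht hst
    have h2 : ∑ i, Γ i * |(s • y + t • y') i - (s • x + t • x') i| ≤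
        s * ∑ i, Γ i * |y i - x i| + t * ∑ i, Γ i * |y' i - x' i| := by
      rw [Finset.mul_sum, Finset.mul_sum, ← Finset.sum_add_distrib]
      refine Finset.sum_le_sum fun i _ => ?_
      have e : (s • y + t • y') i - (s • x + t • x') i = s * (y i - x i) + t * (y' i - x' i) := by
        simp only [Pi.add_apply, Pi.smul_apply, smul_eq_mul]; ring
      have h3 := abs_add_le (s * (y i - x i)) (t * (y' i - x' i))
      rw [abs_mul, abs_mul, abs_of_nonneg hs, abs_of_nonneg ht] at h3
      rw [e]
      nlinarith [hΓ i]
    rw [smul_eq_mul, smul_eq_mul] at h1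
    linarith
  have : Nonempty D := hD.to_subtype
  simp only [smul_eq_mul]
  conv_rhs => rw [lipExtension, lipExtension]
  rw [Real.mul_iInf_of_nonneg hs, Real.mul_iInf_of_nonneg ht]
  exact le_ciInf_add_ciInf fun x x' => key x x.2 x' x'.2

/-- The extension of `φ` to the whole space, transported from the box `Icc a b` to the unit cube and
divided by `M`. -/
noncomputable def normalizedExtension (D : Set (Fin d → ℝ)) (Γ a b : Fin d → ℝ) (M : ℝ)
    (φ : (Fin d → ℝ) → ℝ) (y : EuclideanSpace ℝ (Fin d)) : ℝ :=
  lipExtension D Γ φ (fun i => a i + (b i - a i) * y i) / M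

theorem normalizedExtension_mem {a b : Fin d → ℝ} (hD : D.Nonempty) (hDab : D ⊆ Icc a b)
    (hab : ∀ i, a i < b i) (hB : 0 < B) (hΓ : ∀ i, 0 ≤ Γ i) (hφ : φ ∈ jointLipClass D B Γ) :
    normalizedExtension D Γ a b (B + ∑ i, Γ i * (b i - a i)) φ ∈ normalizedClass d := by
  set M := B + ∑ i, Γ i * (b i - a i) with hM
  have hG : ∀ i, 0 ≤ Γ i * (b i - a i) := fun i => mul_nonneg (hΓ i) (sub_nonneg.2 (hab i).le)
  have hM0 : 0 < M := add_pos_of_pos_of_nonneg hB (Finset.sum_nonneg fun i _ => hG i)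
  refine ⟨⟨convex_univ, fun x _ y _ s t hs ht hst => ?_⟩, fun x y => ?_, ?_⟩
  · have h1 := (convexOn_lipExtension hD hΓ hφ.1.1 hφ.1.2.1).2
      (mem_univ (fun i => a i + (b i - a i) * x i)) (mem_univ (fun i => a i + (b i - a i) * y i))
      hs ht hst
    have e : (fun i => a i + (b i - a i) * (s • x + t • y) i) =
        s • (fun i => a i + (b i - a i) * x i) + t • (fun i => a i + (b i - a i) * y i) := by
      ext i
      simp only [PiLp.add_apply, PiLp.smul_apply, Pi.add_apply, Pi.smul_apply, smul_eq_mul]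
      linear_combination (-a i) * hst
    rw [smul_eq_mul, smul_eq_mul] at h1 ⊢
    rw [normalizedExtension, normalizedExtension, normalizedExtension, e, mul_div_assoc',
      mul_div_assoc', ← add_div]
    exact div_le_div_of_nonneg_right h1 hM0.le
  · rw [normalizedExtension, normalizedExtension, ← sub_div, div_le_iff₀ hM0]
    refine (lipExtension_sub_le hD hΓ hφ.1.2.1 _ _).trans ?_
    calc _ ≤ ∑ i, ‖x - y‖ * (Γ i * (b i - a i)) := by
          refine Finset.sum_le_sum fun i _ => ?_
          have h1 := EuclideanSpace.abs_apply_le_norm (x - y) i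
          rw [PiLp.sub_apply] at h1
          rw [add_sub_add_left_eq_sub, ← mul_sub, abs_mul,
            abs_of_nonneg (sub_nonneg.2 (hab i).le), ← mul_assoc, mul_comm ‖x - y‖]
          exact mul_le_mul_of_nonneg_left h1 (hG i)
      _ = ‖x - y‖ * ∑ i, Γ i * (b i - a i) := by rw [Finset.mul_sum]
      _ ≤ ‖x - y‖ * M := mul_le_mul_of_nonneg_left (by linarith) (norm_nonneg _)
  · rw [normalizedExtension, abs_div, abs_of_pos hM0, div_le_one hM0]
    obtain ⟨x, hx⟩ := hD
    have e : (fun i => a i + (b i - a i) * (0 : EuclideanSpace ℝ (Fin d)) i) = a := by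
      ext i; simp
    have h1 := lipExtension_sub_le ⟨x, hx⟩ hΓ hφ.1.2.1 a x
    have h2 := lipExtension_sub_le ⟨x, hx⟩ hΓ hφ.1.2.1 x a
    have h3 := abs_le.1 (hφ.1.2.1 x hx)
    rw [lipExtension_eq hΓ hφ hx] at h1 h2
    have h4 : ∑ i, Γ i * |x i - a i| ≤ ∑ i, Γ i * (b i - a i) := by
      refine Finset.sum_le_sum fun i _ => mul_le_mul_of_nonneg_left ?_ (hΓ i)
      have h5 := (hDab hx).1 i
      have h6 := (hDab hx).2 i
      rw [abs_of_nonneg (sub_nonneg.2 h5)]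
      linarith
    have h5 : ∑ i, Γ i * |a i - x i| = ∑ i, Γ i * |x i - a i| := by
      simp only [abs_sub_comm]
    rw [e, abs_le]
    constructor <;> linarith [h3.1, h3.2]

end Extension

/-- The entropy bound for convex functions that are jointly Lipschitz on a convex subset
of a box. -/
theorem exists_logBracketingSup_jointLipClass_le {d : ℕ} (hd : 1 ≤ d) : ∃ c : ℝ, 0 < c ∧
    ∀ (a b : Fin d → ℝ) (D : Set (Fin d → ℝ)) (B : ℝ) (Γ : Fin d → ℝ),
      (∀ i, a i < b i) → D ⊆ Icc a b → 0 < B → (∀ i, 0 < Γ i) →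
      ∀ ε : ℝ, 0 < ε → ε ≤ B + ∑ i, Γ i * (b i - a i) →
        logBracketingSup D (jointLipClass D B Γ) ε ≤
          ((c * ((B + ∑ i, Γ i * (b i - a i)) / ε) ^ ((d : ℝ) / 2) : ℝ) : EReal) := by
  obtain ⟨C, hC, hcode⟩ := exists_code_normalizedClass hd
  refine ⟨C * (2 * C) ^ ((d : ℝ) / 2), by positivity, fun a b D B Γ hab hDab hB hΓ ε hε hεM => ?_⟩
  set M := B + ∑ i, Γ i * (b i - a i) with hM
  have hM0 : 0 < M := hε.trans_le hεM
  rcases D.eq_empty_or_nonempty with rfl | hD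
  · refine log_bracketingNumber_le (n := 1) ?_ ?_
    · have := bracketingNumber_sup_le_card_of_code (D := ∅) (F := jointLipClass ∅ B Γ) hε.le
        ({()} : Finset Unit) (fun _ => ()) (by simp) (by simp)
      simpa using this
    · rw [Nat.cast_one]
      exact Real.one_le_exp (by positivity)
  have hw1 : 1 ≤ 2 * C * (M / ε) := by
    have : 1 ≤ M / ε := by rwa [le_div_iff₀ hε, one_mul]
    nlinarith
  -- with `δ = 1 / √w` the error `C * δ ^ 2` is `ε / (2 * M)`, half the rescaled bracket size
  set w := 2 * C * (M / ε) with hw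
  have hw0 : 0 < w := one_pos.trans_le hw1
  obtain ⟨T, S, code, hcard, hS, hclose⟩ := hcode (1 / √w) (by positivity)
    (by
      rw [div_le_one (by positivity)]
      exact Real.one_le_sqrt.2 hw1)
  refine log_bracketingNumber_le (n := S.card) ?_ (hcard.trans (Real.exp_le_exp.2 (le_of_eq ?_)))
  · refine bracketingNumber_sup_le_card_of_code hε.le S
      (fun φ => code (normalizedExtension D Γ a b M φ))
      (fun φ hφ => hS _ (normalizedExtension_mem hD hDab hab hB (fun i => (hΓ i).le) hφ))
      fun φ hφ φ' hφ' h x hx => ?_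
    have h1 := hclose _ (normalizedExtension_mem hD hDab hab hB (fun i => (hΓ i).le) hφ)
      _ (normalizedExtension_mem hD hDab hab hB (fun i => (hΓ i).le) hφ') h
      (WithLp.toLp 2 fun i => (x i - a i) / (b i - a i)) fun i => by
        have h3 := (hDab hx).1 i
        have h4 := (hDab hx).2 i
        have h5 := sub_pos.2 (hab i)
        exact ⟨div_nonneg (sub_nonneg.2 h3) h5.le, (div_le_one h5).2 (by linarith)⟩
    have e : (fun i => a i + (b i - a i) * ((x i - a i) / (b i - a i))) = x := by
      ext i
      rw [mul_div_cancel₀ _ (sub_pos.2 (hab i)).ne']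
      ring
    rw [normalizedExtension, normalizedExtension] at h1
    dsimp only at h1
    rw [e, lipExtension_eq (fun i => (hΓ i).le) hφ hx, lipExtension_eq (fun i => (hΓ i).le) hφ' hx,
      ← sub_div, abs_div, abs_of_pos hM0, div_le_iff₀ hM0, div_pow, Real.sq_sqrt hw0.le, hw] at h1
    refine h1.trans (le_of_eq ?_)
    field_simp
  · rw [one_div_one_div, mul_assoc, ← Real.mul_rpow (by positivity) (by positivity), ← hw,
      Real.sqrt_eq_rpow, ← Real.rpow_natCast, ← Real.rpow_mul hw0.le]
    congr 2
    ring

/-! ### From brackets for the supremum norm to measurable brackets -/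

theorem Convex.restrict_interior_eq {d : ℕ} {D : Set (Fin d → ℝ)} (hD : Convex ℝ D) :
    volume.restrict (interior D) = volume.restrict D :=
  Measure.restrict_congr_set (interior_ae_eq_of_null_frontier (hD.addHaar_frontier volume))

theorem aemeasurable_restrict_of_interior_restrict {d : ℕ} {D : Set (Fin d → ℝ)}
    (hD : Convex ℝ D) {g : (Fin d → ℝ) → ℝ} (hg : Measurable fun x : interior D => g x) :
    AEMeasurable g (volume.restrict D) := by
  rw [← hD.restrict_interior_eq]
  exact aemeasurable_restrict_of_measurable_subtype isOpen_interior.measurableSet hg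

/-- A bracket for the supremum norm may be replaced by the infimum and the supremum of the convex
functions in it. In the interior of the domain these functions are continuous, so that the infimum
is upper and the supremum lower semicontinuous there. -/
theorem logBracketingLp_le_logBracketingSup {d : ℕ} {D : Set (Fin d → ℝ)} (hD : Convex ℝ D)
    (hvol : volume D ≠ ∞) {F : Set ((Fin d → ℝ) → ℝ)} (hF : ∀ f ∈ F, ConvexOn ℝ D f) {p ε : ℝ}
    (hp : 1 ≤ p) (hε : 0 ≤ ε) :
    logBracketingLp D F p (ε * volume.real D ^ (1 / p)) ≤ logBracketingSup D F ε := by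
  refine ENNReal.log_monotone (ENat.toENNReal_le.2 ?_)
  refine bracketingNumber_le_bracketingNumber subset_rfl fun l u _ hsmall => ?_
  let G := {f : (Fin d → ℝ) → ℝ // f ∈ F ∧ ∀ x ∈ D, l x ≤ f x ∧ f x ≤ u x}
  have hbelow : ∀ x ∈ D, BddBelow (range fun f : G => f.1 x) := by
    rintro x hx
    exact ⟨l x, by rintro _ ⟨f, rfl⟩; exact (f.2.2 x hx).1⟩
  have habove : ∀ x ∈ D, BddAbove (range fun f : G => f.1 x) := by
    rintro x hx
    exact ⟨u x, by rintro _ ⟨f, rfl⟩; exact (f.2.2 x hx).2⟩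
  have hcont : ∀ f : G, Continuous fun x : interior D => f.1 x := fun f =>
    continuousOn_iff_continuous_domRestrict.1 (hF _ f.2.1).continuousOn_interior
  have hle : ∀ x ∈ D, ⨅ f : G, f.1 x ≤ ⨆ f : G, f.1 x := by
    intro x hx
    rcases isEmpty_or_nonempty G with hG | ⟨⟨f⟩⟩
    · simp
    · exact (ciInf_le (hbelow x hx) f).trans (le_ciSup (habove x hx) f)
  have hdiff : ∀ x ∈ D, (⨆ f : G, f.1 x) - ⨅ f : G, f.1 x ≤ ε := by
    intro x hx
    rcases isEmpty_or_nonempty G with hG | hG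
    · simpa using hε
    · have h1 : l x ≤ ⨅ f : G, f.1 x := le_ciInf fun f => (f.2.2 x hx).1
      have h2 : ⨆ f : G, f.1 x ≤ u x := ciSup_le fun f => (f.2.2 x hx).2
      linarith [(abs_le.1 (hsmall x hx)).2]
  -- if the bracket has no member, infimum and supremum are both `0` by convention
  refine ⟨fun x => ⨅ f : G, f.1 x, fun x => ⨆ f : G, f.1 x, hle, ⟨?_, ?_, ?_⟩, fun f hf hlu x hx =>
    ⟨ciInf_le (hbelow x hx) ⟨f, hf, hlu⟩, le_ciSup (habove x hx) (⟨f, hf, hlu⟩ : G)⟩⟩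
  · refine aemeasurable_restrict_of_interior_restrict hD (UpperSemicontinuous.measurable ?_)
    exact upperSemicontinuous_ciInf (fun x => hbelow x (interior_subset x.2))
      fun f => (hcont f).upperSemicontinuous
  · refine aemeasurable_restrict_of_interior_restrict hD (LowerSemicontinuous.measurable ?_)
    exact lowerSemicontinuous_ciSup (fun x => habove x (interior_subset x.2))
      fun f => (hcont f).lowerSemicontinuous
  · have hae : ∀ᵐ x ∂volume.restrict D, ‖(⨆ f : G, f.1 x) - ⨅ f : G, f.1 x‖ ≤ ε := by
      rw [← hD.restrict_interior_eq]
      filter_upwards [ae_restrict_mem isOpen_interior.measurableSet] with x hx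
      have hxD := interior_subset hx
      rw [Real.norm_eq_abs, abs_of_nonneg (sub_nonneg.2 (hle x hxD))]
      exact hdiff x hxD
    refine (eLpNorm_le_of_ae_bound hae).trans (le_of_eq ?_)
    have hp0 : 0 ≤ p := by linarith
    rw [Measure.restrict_apply_univ, ENNReal.toReal_ofReal hp0, ENNReal.ofReal_mul hε, mul_comm,
      ← ENNReal.ofReal_rpow_of_nonneg measureReal_nonneg (by positivity), measureReal_def,
      ENNReal.ofReal_toReal hvol, one_div]

/-- The boundary of a convex set is a null set, so brackets of size measured by `L_p` may be chosen
trivially on it. -/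
theorem logBracketingLp_le_logBracketingLp_interior {d : ℕ} {D : Set (Fin d → ℝ)}
    (hD : Convex ℝ D) {F F' : Set ((Fin d → ℝ) → ℝ)} (hFF : F ⊆ F') {B : ℝ} (hB : 0 ≤ B)
    (hFB : ∀ f ∈ F, ∀ x ∈ D, |f x| ≤ B) (p ε : ℝ) :
    logBracketingLp D F p ε ≤ logBracketingLp (interior D) F' p ε := by
  classical
  refine ENNReal.log_monotone (ENat.toENNReal_le.2 ?_)
  refine bracketingNumber_le_bracketingNumber hFF fun l u hlu hsmall => ?_
  rw [hD.restrict_interior_eq] at hsmall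
  have hae : ∀ (g : (Fin d → ℝ) → ℝ) (t : ℝ),
      (interior D).piecewise g (fun _ => t) =ᵐ[volume.restrict D] g := by
    intro g t
    rw [← hD.restrict_interior_eq]
    exact piecewise_ae_eq_restrict isOpen_interior.measurableSet
  refine ⟨(interior D).piecewise l fun _ => -B, (interior D).piecewise u fun _ => B,
    fun x _ => ?_, ⟨hsmall.1.congr (hae l _).symm, hsmall.2.1.congr (hae u _).symm, ?_⟩,
    fun f hf h x hx => ?_⟩
  · by_cases hx : x ∈ interior D
    · simpa [hx] using hlu x hx
    · simpa [hx] using hB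
  · refine le_trans (le_of_eq ?_) hsmall.2.2
    exact eLpNorm_congr_ae ((hae u B).sub (hae l (-B)))
  · by_cases hxi : x ∈ interior D
    · simpa [hxi] using h x hxi
    · simpa [hxi, abs_le] using hFB f hf x hx

/-! ### Joint Lipschitz condition from the one along the axes -/

section Lipschitz

variable {d : ℕ} {D : Set (Fin d → ℝ)} {B : ℝ} {Γ : Fin d → ℝ} {φ : (Fin d → ℝ) → ℝ}

/-- If all vertices of the box spanned by `y` and `x` belong to `D`, one can go from `y` to `x`
inside `D` along the axes. -/
theorem abs_sub_le_of_forall_piecewise_mem (hφ : φ ∈ coordLipClass D B Γ) {x y : Fin d → ℝ}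
    (h : ∀ z : Fin d → ℝ, (∀ i, z i = x i ∨ z i = y i) → z ∈ D) :
    |φ x - φ y| ≤ ∑ i, Γ i * |x i - y i| := by
  have hmem : ∀ s : Finset (Fin d), s.piecewise x y ∈ D := fun s => h _ fun i => by
    by_cases hi : i ∈ s <;> simp [hi]
  have key : ∀ s : Finset (Fin d), |φ (s.piecewise x y) - φ y| ≤ ∑ i ∈ s, Γ i * |x i - y i| := by
    intro s
    induction s using Finset.induction_on with
    | empty => simp
    | insert j s hj ih =>
      have e : (insert j s).piecewise x y =
          s.piecewise x y + (x j - y j) • (Pi.single j 1 : Fin d → ℝ) := by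
        ext i
        rcases eq_or_ne i j with rfl | hij
        · simp [hj]
        · by_cases hi : i ∈ s <;> simp [hi, hij]
      have h1 := hφ.2.2 j (s.piecewise x y) (x j - y j) (hmem s) (e ▸ hmem (insert j s))
      rw [← e] at h1
      rw [Finset.sum_insert hj]
      exact (abs_sub_le _ (φ (s.piecewise x y)) _).trans (add_le_add h1 ih)
  simpa using key Finset.univ

theorem jointLipClass_Icc (a b : Fin d → ℝ) (B : ℝ) (Γ : Fin d → ℝ) :
    jointLipClass (Icc a b) B Γ = coordLipClass (Icc a b) B Γ := by
  refine Subset.antisymm (fun φ hφ => hφ.1) fun φ hφ => ⟨hφ, fun x hx y hy => ?_⟩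
  refine abs_sub_le_of_forall_piecewise_mem hφ fun z hz => ⟨fun i => ?_, fun i => ?_⟩
  · rcases hz i with h | h <;> rw [h]
    exacts [hx.1 i, hy.1 i]
  · rcases hz i with h | h <;> rw [h]
    exacts [hx.2 i, hy.2 i]

/-- In an open convex set, the segment between two points has a neighbourhood inside the set, so
it can be divided into steps for which the walk along the axes stays inside. -/
theorem jointLipClass_of_isOpen (hDo : IsOpen D) (hDc : Convex ℝ D) (B : ℝ) (Γ : Fin d → ℝ) :
    jointLipClass D B Γ = coordLipClass D B Γ := by
  refine Subset.antisymm (fun φ hφ => hφ.1) fun φ hφ => ⟨hφ, fun x hx y hy => ?_⟩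
  have hcomp : IsCompact (segment ℝ y x) := by
    rw [segment_eq_image_lineMap]
    exact isCompact_Icc.image AffineMap.lineMap_continuous
  obtain ⟨r, hr, hrD⟩ := hcomp.exists_thickening_subset_open hDo (hDc.segment_subset hy hx)
  obtain ⟨n, hn⟩ := exists_nat_gt (‖x - y‖ / r)
  have hn0 : (0 : ℝ) < n := lt_of_le_of_lt (by positivity) hn
  set q : ℕ → (Fin d → ℝ) := fun k => y + ((k : ℝ) / n) • (x - y) with hq
  have hstep : ∀ k : ℕ, ∀ i, q (k + 1) i - q k i = (x i - y i) / n := by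
    intro k i
    simp only [hq, Pi.add_apply, Pi.smul_apply, Pi.sub_apply, smul_eq_mul, Nat.cast_add,
      Nat.cast_one]
    ring
  have hone : ∀ k < n, |φ (q (k + 1)) - φ (q k)| ≤ ∑ i, Γ i * (|x i - y i| / n) := by
    intro k hk
    have h1 : |φ (q (k + 1)) - φ (q k)| ≤ ∑ i, Γ i * |q (k + 1) i - q k i| := by
      refine abs_sub_le_of_forall_piecewise_mem hφ fun z hz => hrD ?_
      have hseg : q k ∈ segment ℝ y x := by
        rw [segment_eq_image']
        refine ⟨(k : ℝ) / n, ⟨by positivity, (div_le_one hn0).2 (by exact_mod_cast hk.le)⟩, rfl⟩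
      refine Metric.mem_thickening_iff.2 ⟨q k, hseg, (dist_pi_lt_iff hr).2 fun i => ?_⟩
      have h2 : |x i - y i| / n < r := by
        rw [div_lt_iff₀ hn0]
        rw [div_lt_iff₀ hr] at hn
        have h3 : |x i - y i| ≤ ‖x - y‖ := norm_le_pi_norm (x - y) i
        linarith
      rw [Real.dist_eq]
      rcases hz i with h | h
      · rw [h, hstep, abs_div, abs_of_pos hn0]
        exact h2
      · rw [h, sub_self, abs_zero]
        exact hr
    simpa only [hstep, abs_div, abs_of_pos hn0] using h1
  have hsum : ∀ k ≤ n, |φ (q k) - φ (q 0)| ≤ k * ∑ i, Γ i * (|x i - y i| / n) := by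
    intro k
    induction k with
    | zero => simp
    | succ k ih =>
      intro hk
      have h1 := ih (by omega)
      have h2 := hone k (by omega)
      have h3 := abs_sub_le (φ (q (k + 1))) (φ (q k)) (φ (q 0))
      push_cast
      linarith
  have hfin := hsum n le_rfl
  have e1 : q n = x := by simp [hq, div_self hn0.ne']
  have e0 : q 0 = y := by simp [hq]
  rw [e1, e0, Finset.mul_sum] at hfin
  refine hfin.trans (le_of_eq (Finset.sum_congr rfl fun i _ => ?_))
  field_simp

theorem coordLipClass_subset {D' : Set (Fin d → ℝ)} (hD' : Convex ℝ D') (h : D' ⊆ D) (B : ℝ)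
    (Γ : Fin d → ℝ) : coordLipClass D B Γ ⊆ coordLipClass D' B Γ := fun _ hφ =>
  ⟨hφ.1.subset h hD', fun x hx => hφ.2.1 x (h hx), fun i x t hx hxt =>
    hφ.2.2 i x t (h hx) (h hxt)⟩

theorem coordLipClass_subset_jointLipClass_interior (hD : Convex ℝ D) (B : ℝ) (Γ : Fin d → ℝ) :
    coordLipClass D B Γ ⊆ jointLipClass (interior D) B Γ := by
  rw [jointLipClass_of_isOpen isOpen_interior hD.interior]
  exact coordLipClass_subset hD.interior interior_subset B Γ

theorem continuousOn_of_mem_jointLipClass (hΓ : ∀ i, 0 ≤ Γ i) (hφ : φ ∈ jointLipClass D B Γ) :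
    ContinuousOn φ D := by
  refine (LipschitzOnWith.of_dist_le_mul (K := (∑ i, Γ i).toNNReal)
    fun x hx y hy => ?_).continuousOn
  rw [Real.dist_eq, Real.coe_toNNReal _ (Finset.sum_nonneg fun i _ => hΓ i), Finset.sum_mul]
  refine (hφ.2 x hx y hy).trans (Finset.sum_le_sum fun i _ => ?_)
  exact mul_le_mul_of_nonneg_left (dist_le_pi_dist x y i) (hΓ i)

theorem jointLipClass_eq_of_nonempty_interior (hD : Convex ℝ D) (hΓ : ∀ i, 0 ≤ Γ i)
    (hi : (interior D).Nonempty) (B : ℝ) :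
    jointLipClass D B Γ = {φ | φ ∈ coordLipClass D B Γ ∧ ContinuousOn φ D} := by
  refine Subset.antisymm (fun φ hφ => ⟨hφ.1, continuousOn_of_mem_jointLipClass hΓ hφ⟩) ?_
  rintro φ ⟨hφ, hc⟩
  refine ⟨hφ, ?_⟩
  have hcl : ∀ x ∈ D, x ∈ closure (interior D) := fun x hx => by
    rw [hD.closure_interior_eq_closure_of_nonempty_interior hi]
    exact subset_closure hx
  have hci : ∀ x ∈ D, ContinuousWithinAt φ (interior D) x := fun x hx =>
    (hc x hx).mono interior_subset
  have hint := (coordLipClass_subset_jointLipClass_interior hD B Γ hφ).2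
  have h1 : ∀ x ∈ interior D, ∀ y ∈ D, |φ x - φ y| ≤ ∑ i, Γ i * |x i - y i| := fun x hx y hy =>
    ContinuousWithinAt.closure_le (f := fun y => |φ x - φ y|)
      (g := fun y => ∑ i, Γ i * |x i - y i|) (hcl y hy)
      ((continuousWithinAt_const.sub (hci y hy)).abs) (Continuous.continuousWithinAt (by fun_prop))
    fun y hy => hint x hx y hy
  intro x hx y hy
  exact ContinuousWithinAt.closure_le (f := fun x => |φ x - φ y|)
    (g := fun x => ∑ i, Γ i * |x i - y i|) (hcl x hx)
    (((hci x hx).sub continuousWithinAt_const).abs) (Continuous.continuousWithinAt (by fun_prop))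
    fun x hx => h1 x hx y hy

end Lipschitz

theorem mainTheorem3 (d : ℕ) (hd : 1 ≤ d) :
    ∃ c ε₀ : ℝ, 0 < c ∧ 0 < ε₀ ∧
      ∀ (a b : Fin d → ℝ) (D : Set (Fin d → ℝ)) (B : ℝ) (Γ : Fin d → ℝ),
        (∀ i, a i < b i) → Convex ℝ D → D ⊆ Set.Icc a b → 0 < B → (∀ i, 0 < Γ i) →
        (∀ ε : ℝ, 0 < ε → ε ≤ ε₀ * (B + ∑ i, Γ i * (b i - a i)) →
          (∀ p : ℝ, 1 ≤ p →
            logBracketingLp D (coordLipClass D B Γ) p (ε * (volume.real D) ^ (1 / p)) ≤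
                logBracketingSup D (coordLipClass D B Γ) ε ∧
            logBracketingLp D (coordLipClass D B Γ) p (ε * (volume.real D) ^ (1 / p)) ≤
                ((c * ((B + ∑ i, Γ i * (b i - a i)) / ε) ^ ((d : ℝ) / 2) : ℝ) : EReal) ∧
            logBracketingLp D (jointLipClass D B Γ) p (ε * (volume.real D) ^ (1 / p)) ≤
                logBracketingSup D (jointLipClass D B Γ) ε) ∧
          logBracketingSup D (jointLipClass D B Γ) ε ≤
            ((c * ((B + ∑ i, Γ i * (b i - a i)) / ε) ^ ((d : ℝ) / 2) : ℝ) : EReal)) ∧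
        ((interior D).Nonempty →
          jointLipClass D B Γ = {φ | φ ∈ coordLipClass D B Γ ∧ ContinuousOn φ D}) ∧
        (IsOpen D ∨ D = Set.Icc a b → jointLipClass D B Γ = coordLipClass D B Γ) := by
  obtain ⟨c, hc, hmain⟩ := exists_logBracketingSup_jointLipClass_le hd
  refine ⟨c, 1, hc, one_pos, fun a b D B Γ hab hD hDab hB hΓ => ⟨fun ε hε hεM => ?_,
    fun hi => jointLipClass_eq_of_nonempty_interior hD (fun i => (hΓ i).le) hi B, ?_⟩⟩
  · rw [one_mul] at hεM
    have hvol : volume D ≠ ∞ :=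
      ((measure_mono hDab).trans_lt isCompact_Icc.measure_lt_top).ne
    refine ⟨fun p hp => ⟨?_, ?_, ?_⟩, hmain a b D B Γ hab hDab hB hΓ ε hε hεM⟩
    · exact logBracketingLp_le_logBracketingSup hD hvol (fun f hf => hf.1) hp hε.le
    · have hreal : volume.real (interior D) = volume.real D :=
        measureReal_congr (interior_ae_eq_of_null_frontier (hD.addHaar_frontier volume))
      calc _ ≤ logBracketingLp (interior D) (jointLipClass (interior D) B Γ) p
              (ε * volume.real D ^ (1 / p)) :=
            logBracketingLp_le_logBracketingLp_interior hD
              (coordLipClass_subset_jointLipClass_interior hD B Γ) hB.le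
              (fun f hf => hf.2.1) p _
        _ ≤ logBracketingSup (interior D) (jointLipClass (interior D) B Γ) ε := by
            rw [← hreal]
            exact logBracketingLp_le_logBracketingSup hD.interior
              (measure_ne_top_of_subset interior_subset hvol) (fun f hf => hf.1.1) hp hε.le
        _ ≤ _ := hmain a b _ B Γ hab (interior_subset.trans hDab) hB hΓ ε hε hεM
    · exact logBracketingLp_le_logBracketingSup hD hvol (fun f hf => hf.1.1) hp hε.le
  · rintro (ho | rfl)
    · exact jointLipClass_of_isOpen ho hD B Γ
    · exact jointLipClass_Icc a b B Γ
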